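/- There exist absolute constants $c_1,c_2>0$ such that the following holds for all $p\in[2,3]$, all integers $d,N\ge 1$ and all $0\le\varepsilon<1/2$. Let $\mathcal P$ be the class of all probability distributions $P$ on $\mathbb R^d$ with finite mean $\mu(P)$ and $$\sup_{\|v\|_2=1}\mathbb E_{X\sim P}\,|\langle X-\mu(P),v\rangle|^p\le 1,$$ and write $\Sigma_P$ for the covariance matrix of $P$. Let $\widehat\mu:(\mathbb R^d)^N\to\mathbb R^d$ be an arbitrary measurable map (an estimator), and let $\Pr_{P,Q}$ denote probability when $X_1,\dots,X_N$ are i.i.d. with distribution $(1-\varepsilon)P+\varepsilon Q$. Then $$\sup_{P\in\mathcal P,\;Q}\Pr\nolimits_{P,Q}\left\{\|\widehat\mu(X_1,\dots,X_N)-\mu(P)\|_2\ \ge\ c_1\left(\sqrt{\frac{\operatorname{tr}\Sigma_P}{N}}\ \vee\ \varepsilon^{1-1/p}\right)\right\}\ \ge\ c_2,$$ where $Q$ ranges over all probability distributions on $\mathbb R^d$. Moreover, the term $\sqrt{\operatorname{tr}\Sigma/N}$ is unavoidable for each prescribed covariance matrix: for every symmetric positive semidefinite $d\times d$ matrix $\Sigma$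 with largest eigenvalue at most $1/2$, $$\sup_{P\in\mathcal P,\;\Sigma_P=\Sigma,\;Q}\Pr\nolimits_{P,Q}\left\{\|\widehat\mu(X_1,\dots,X_N)-\mu(P)\|_2\ \ge\ c_1\sqrt{\frac{\operatorname{tr}\Sigma}{N}}\right\}\ \ge\ c_2.$$ -/

import Mathlib

open MeasureTheory ProbabilityTheory
open scoped ENNReal Matrix

noncomputable section

/-- The mean `μ(P)` of a distribution on `ℝ^d`. -/
def distMean {d : ℕ} (P : Measure (EuclideanSpace ℝ (Fin d))) : EuclideanSpace ℝ (Fin d) :=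
  ∫ x, x ∂P

/-- The covariance matrix `Σ` of a distribution on `ℝ^d`. -/
def distCov {d : ℕ} (P : Measure (EuclideanSpace ℝ (Fin d))) : Matrix (Fin d) (Fin d) ℝ :=
  Matrix.of fun i j => cov[fun x => x i, fun x => x j; P]

/-- The class of probability distributions on `ℝ^d` whose centered one-dimensional projections
have `p`-th absolute moments at most `1`. The moments are `[0, ∞]`-valued integrals, so that the
bound includes their finiteness. -/
structure BoundedMomentClass (p : ℝ) {d : ℕ} (P : Measure (EuclideanSpace ℝ (Fin d))) : Prop where
  isProb : IsProbabilityMeasure P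
  integrable : Integrable (fun x => x) P
  moment_le : ∀ v : EuclideanSpace ℝ (Fin d), ‖v‖ = 1 →
    ∫⁻ x, ENNReal.ofReal (|inner ℝ (x - distMean P) v| ^ p) ∂P ≤ 1

/-- The contaminated distribution `(1 - ε) P + ε Q`. -/
def contaminated {d : ℕ} (ε : ℝ) (P Q : Measure (EuclideanSpace ℝ (Fin d))) :
    Measure (EuclideanSpace ℝ (Fin d)) :=
  ENNReal.ofReal (1 - ε) • P + ENNReal.ofReal ε • Q

/-- The joint law of an i.i.d. sample `X₁, …, X_N` from `(1 - ε) P + ε Q`. -/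
def sampleLaw {d : ℕ} (N : ℕ) (ε : ℝ) (P Q : Measure (EuclideanSpace ℝ (Fin d))) :
    Measure (Fin N → EuclideanSpace ℝ (Fin d)) :=
  Measure.pi fun _ => contaminated ε P Q

/-- The probability that the estimator `est` of the mean of `P`, computed from an i.i.d. sample of
size `N` from `(1 - ε) P + ε Q`, has Euclidean error at least `r`. -/
def errorProb {d N : ℕ} (ε : ℝ) (est : (Fin N → EuclideanSpace ℝ (Fin d)) → EuclideanSpace ℝ (Fin d))
    (P Q : Measure (EuclideanSpace ℝ (Fin d))) (r : ℝ) : ℝ≥0∞ :=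
  sampleLaw N ε P Q {X | r ≤ ‖est X - distMean P‖}

end

/-! The two error sources need separate constructions.

Covariance: take `Q = P`, so contamination does nothing. In an eigenbasis of `Σ` place independent
signs scaled by `a i` and biased by `± η`, with `η ^ 2 = 1 / (4 * N)` and variances equal to the
eigenvalues of `Σ`. All `2 ^ d` bias patterns have covariance `Σ`, and patterns differing in one
coordinate cannot be told apart reliably from `N` samples. Assouad's argument
(`sum_sampleWeight_mul_hamming_ge`, `exists_signs_error_ge`) gives squared error of order `tr Σ /
N`. Membership in the class follows from the fourth-moment bound
`sum_signWeight_mul_signDev_pow_four_le`, interpolated down to `p`.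

Contamination: a point mass at the origin and a law with mass `ε` at distance `ε ^ (-1 / p)` become
identical under suitable contamination, while their means differ by `ε ^ (1 - 1 / p)`; no estimator
serves both (`half_le_errorProb_or`).

The larger of the two rates decides which is used, with `Σ = I / 2` in the covariance case. The
radius involves the covariance of `P` itself, so the two-point laws must also have small trace: it
is at most `1` in every dimension. -/

/-! ### Moments of linear combinations of biased signs -/

/-- The sign `±1` encoded by a Boolean. -/
noncomputable def boolSign (b : Bool) : ℝ := if b then 1 else -1

@[simp] lemma boolSign_true : boolSign true = 1 := rfl

@[simp] lemma boolSign_false : boolSign false = -1 := rfl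

lemma boolSign_sq (b : Bool) : boolSign b ^ 2 = 1 := by cases b <;> norm_num

/-- The probability of `ω` when its signs are independent with means `h i`. -/
noncomputable def signWeight {n : ℕ} (h : Fin n → ℝ) (ω : Fin n → Bool) : ℝ :=
  ∏ i, (1 + h i * boolSign (ω i)) / 2

/-- The linear combination with coefficients `a i` of the signs of `ω` centered at `h i`. -/
noncomputable def signDev {n : ℕ} (a h : Fin n → ℝ) (ω : Fin n → Bool) : ℝ :=
  ∑ i, a i * (boolSign (ω i) - h i)

lemma signFactor_nonneg {h : ℝ} (hh : |h| ≤ 1) (b : Bool) : 0 ≤ (1 + h * boolSign b) / 2 := by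
  have := abs_le.mp hh
  cases b <;> simp only [boolSign_true, boolSign_false] <;> linarith

lemma signWeight_nonneg {n : ℕ} {h : Fin n → ℝ} (hh : ∀ i, |h i| ≤ 1) (ω : Fin n → Bool) :
    0 ≤ signWeight h ω :=
  Finset.prod_nonneg fun i _ => signFactor_nonneg (hh i) (ω i)

lemma sum_signWeight {n : ℕ} (h : Fin n → ℝ) : ∑ ω, signWeight h ω = 1 := by
  have := Finset.prod_univ_sum (fun _ : Fin n => (Finset.univ : Finset Bool))
    (fun i b => (1 + h i * boolSign b) / 2)
  rw [Fintype.piFinset_univ] at this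
  simp only [signWeight]
  rw [← this]
  refine Finset.prod_eq_one fun i _ => ?_
  simp
  ring

/-- Averaging out the first sign: the induction step for all the moment computations. -/
lemma sum_signWeight_succ {n : ℕ} (h : Fin (n + 1) → ℝ) (F : (Fin (n + 1) → Bool) → ℝ) :
    ∑ ω, signWeight h ω * F ω = ∑ ω : Fin n → Bool, signWeight (fun i => h i.succ) ω *
      ((1 + h 0) / 2 * F (Fin.cons true ω) + (1 - h 0) / 2 * F (Fin.cons false ω)) := by
  rw [← (Fin.consEquiv fun _ : Fin (n + 1) => Bool).sum_comp, Fintype.sum_prod_type,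
    Fintype.sum_bool, ← Finset.sum_add_distrib]
  refine Finset.sum_congr rfl fun ω _ => ?_
  have hc : ∀ b, Fin.consEquiv (fun _ : Fin (n + 1) => Bool) (b, ω) = Fin.cons b ω := fun _ => rfl
  simp only [hc, signWeight, Fin.prod_univ_succ, Fin.cons_zero, Fin.cons_succ,
    boolSign_true, boolSign_false]
  ring

lemma signDev_cons {n : ℕ} (a h : Fin (n + 1) → ℝ) (b : Bool) (ω : Fin n → Bool) :
    signDev a h (Fin.cons b ω) = a 0 * (boolSign b - h 0) +
      signDev (fun i => a i.succ) (fun i => h i.succ) ω := by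
  simp [signDev, Fin.sum_univ_succ]

lemma sum_signWeight_mul_signDev {n : ℕ} (a h : Fin n → ℝ) :
    ∑ ω, signWeight h ω * signDev a h ω = 0 := by
  induction n with
  | zero => simp [signDev]
  | succ n ih =>
    rw [sum_signWeight_succ, ← ih (fun i => a i.succ) (fun i => h i.succ)]
    refine Finset.sum_congr rfl fun ω _ => ?_
    simp only [signDev_cons, boolSign_true, boolSign_false]
    ring

lemma sum_signWeight_mul_signDev_sq {n : ℕ} (a h : Fin n → ℝ) :
    ∑ ω, signWeight h ω * signDev a h ω ^ 2 = ∑ i, a i ^ 2 * (1 - h i ^ 2) := by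
  induction n with
  | zero => simp [signDev]
  | succ n ih =>
    have e : a 0 ^ 2 * (1 - h 0 ^ 2) =
        ∑ ω, a 0 ^ 2 * (1 - h 0 ^ 2) * signWeight (fun i => h i.succ) ω := by
      rw [← Finset.mul_sum, sum_signWeight, mul_one]
    rw [sum_signWeight_succ, Fin.sum_univ_succ, ← ih (fun i => a i.succ) (fun i => h i.succ), e,
      ← Finset.sum_add_distrib]
    refine Finset.sum_congr rfl fun ω _ => ?_
    simp only [signDev_cons, boolSign_true, boolSign_false]
    ring

lemma sum_signWeight_mul_signDev_mul {n : ℕ} (a b h : Fin n → ℝ) :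
    ∑ ω, signWeight h ω * (signDev a h ω * signDev b h ω) =
      ∑ i, a i * b i * (1 - h i ^ 2) := by
  have h1 := sum_signWeight_mul_signDev_sq (fun i => a i + b i) h
  have h2 := sum_signWeight_mul_signDev_sq (fun i => a i - b i) h
  have e1 : ∀ ω, signDev (fun i => a i + b i) h ω = signDev a h ω + signDev b h ω := fun ω => by
    simp [signDev, add_mul, Finset.sum_add_distrib]
  have e2 : ∀ ω, signDev (fun i => a i - b i) h ω = signDev a h ω - signDev b h ω := fun ω => by
    simp [signDev, sub_mul, Finset.sum_sub_distrib]
  simp only [e1] at h1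
  simp only [e2] at h2
  have h3 := congrArg₂ (· - ·) h1 h2
  simp only [← Finset.sum_sub_distrib] at h3
  refine mul_left_cancel₀ (four_ne_zero (α := ℝ)) ?_
  rw [Finset.mul_sum, Finset.mul_sum]
  calc _ = _ := Finset.sum_congr rfl fun ω _ => by ring
    _ = _ := h3
    _ = _ := Finset.sum_congr rfl fun i _ => by ring

/-- Adding an independent centered sign creates the cross term `6 v V` and its own fourth moment;
the term linear in the old sum vanishes. The new fourth moment is at most `3 v ^ 2` because `1 + 3 h
^ 2 ≤ 3 (1 - h ^ 2)` when `h ^ 2 ≤ 1 / 3`. -/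
lemma sum_signWeight_mul_signDev_pow_four_le {n : ℕ} (a h : Fin n → ℝ)
    (hh : ∀ i, h i ^ 2 ≤ 1 / 3) :
    ∑ ω, signWeight h ω * signDev a h ω ^ 4 ≤ 3 * (∑ i, a i ^ 2 * (1 - h i ^ 2)) ^ 2 := by
  induction n with
  | zero => simp [signDev]
  | succ n ih =>
    have ih := ih (fun i => a i.succ) (fun i => h i.succ) fun i => hh i.succ
    have e0 := sum_signWeight fun i => h i.succ
    have e1 := sum_signWeight_mul_signDev (fun i => a i.succ) (fun i => h i.succ)
    have e2 := sum_signWeight_mul_signDev_sq (fun i => a i.succ) (fun i => h i.succ)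
    rw [sum_signWeight_succ, Fin.sum_univ_succ]
    have key : ∑ ω : Fin n → Bool, signWeight (fun i => h i.succ) ω *
        ((1 + h 0) / 2 * signDev a h (Fin.cons true ω) ^ 4 +
          (1 - h 0) / 2 * signDev a h (Fin.cons false ω) ^ 4) =
        ∑ ω : Fin n → Bool, signWeight (fun i => h i.succ) ω *
          signDev (fun i => a i.succ) (fun i => h i.succ) ω ^ 4 +
        6 * (a 0 ^ 2 * (1 - h 0 ^ 2)) * ∑ ω : Fin n → Bool, signWeight (fun i => h i.succ) ω *
          signDev (fun i => a i.succ) (fun i => h i.succ) ω ^ 2 +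
        4 * a 0 ^ 3 * (1 - h 0 ^ 2) * (-2 * h 0) *
          ∑ ω : Fin n → Bool, signWeight (fun i => h i.succ) ω *
            signDev (fun i => a i.succ) (fun i => h i.succ) ω +
        a 0 ^ 4 * (1 - h 0 ^ 2) * (1 + 3 * h 0 ^ 2) *
          ∑ ω : Fin n → Bool, signWeight (fun i => h i.succ) ω := by
      simp only [Finset.mul_sum, ← Finset.sum_add_distrib]
      refine Finset.sum_congr rfl fun ω _ => ?_
      simp only [signDev_cons, boolSign_true, boolSign_false]
      ring
    rw [key, e0, e1, e2]
    have h0 := hh 0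
    have : a 0 ^ 4 * (1 - h 0 ^ 2) * (1 + 3 * h 0 ^ 2) ≤ 3 * (a 0 ^ 2 * (1 - h 0 ^ 2)) ^ 2 := by
      have : 0 ≤ a 0 ^ 4 * (1 - h 0 ^ 2) * (2 - 6 * h 0 ^ 2) := by
        refine mul_nonneg (mul_nonneg (by positivity) ?_) ?_ <;> linarith
      nlinarith
    nlinarith

/-- Weighted AM-GM applied to `|x| ^ p = (x ^ 2) ^ (2 - p / 2) * (x ^ 4) ^ (p / 2 - 1)`. -/
lemma abs_rpow_le_add {p : ℝ} (hp : 2 ≤ p) (hp' : p ≤ 4) (x : ℝ) :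
    |x| ^ p ≤ (2 - p / 2) * x ^ 2 + (p / 2 - 1) * x ^ 4 := by
  have h := Real.geom_mean_le_arith_mean2_weighted (w₁ := 2 - p / 2) (w₂ := p / 2 - 1)
    (p₁ := |x| ^ 2) (p₂ := |x| ^ 4) (by linarith) (by linarith) (by positivity) (by positivity)
    (by ring)
  rw [← Real.rpow_natCast, ← Real.rpow_natCast, ← Real.rpow_mul (abs_nonneg x),
    ← Real.rpow_mul (abs_nonneg x), ← Real.rpow_add_of_nonneg (abs_nonneg x)
      (mul_nonneg (by norm_num) (by linarith)) (mul_nonneg (by norm_num) (by linarith))] at h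
  push_cast at h
  have e : 2 * (2 - p / 2) + 4 * (p / 2 - 1) = p := by ring
  rw [e] at h
  norm_cast at h
  rwa [sq_abs, (by decide : Even 4).pow_abs] at h

/-- Independent centered signs with small biases are subgaussian enough that a linear combination
of variance at most `1 / 2` has absolute moments of order `2 ≤ p ≤ 3` at most `1`. -/
lemma sum_signWeight_mul_abs_signDev_rpow_le_one {n : ℕ} {p : ℝ} (hp : 2 ≤ p) (hp' : p ≤ 3)
    (a h : Fin n → ℝ) (hh : ∀ i, h i ^ 2 ≤ 1 / 3)
    (hv : ∑ i, a i ^ 2 * (1 - h i ^ 2) ≤ 1 / 2) :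
    ∑ ω, signWeight h ω * |signDev a h ω| ^ p ≤ 1 := by
  have hpos : ∀ ω, 0 ≤ signWeight h ω := signWeight_nonneg fun i =>
    abs_le_one_iff_mul_self_le_one.mpr (by nlinarith [hh i])
  have hV : 0 ≤ ∑ i, a i ^ 2 * (1 - h i ^ 2) := Finset.sum_nonneg fun i _ =>
    mul_nonneg (sq_nonneg _) (by linarith [hh i])
  have h4 := sum_signWeight_mul_signDev_pow_four_le a h hh
  have h2 := sum_signWeight_mul_signDev_sq a h
  calc _ ≤ ∑ ω, signWeight h ω *
        ((2 - p / 2) * signDev a h ω ^ 2 + (p / 2 - 1) * signDev a h ω ^ 4) :=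
        Finset.sum_le_sum fun ω _ =>
          mul_le_mul_of_nonneg_left (abs_rpow_le_add hp (by linarith) _) (hpos ω)
    _ = (2 - p / 2) * ∑ ω, signWeight h ω * signDev a h ω ^ 2 +
        (p / 2 - 1) * ∑ ω, signWeight h ω * signDev a h ω ^ 4 := by
        simp only [Finset.mul_sum, ← Finset.sum_add_distrib]
        exact Finset.sum_congr rfl fun ω _ => by ring
    _ ≤ 1 := by
        -- Variance at most `1 / 2` makes the fourth moment at most `3 / 4`; the interpolation
        -- weights sum to `1`.
        have h4' : ∑ ω, signWeight h ω * signDev a h ω ^ 4 ≤ 1 := by nlinarith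
        rw [← h2] at hv
        nlinarith

/-! ### Hellinger affinity and Assouad's argument -/

/-- Cauchy–Schwarz on `f g = max f g * min f g`, with total mass of the maximum at most `2`. -/
lemma sq_sum_sqrt_mul_le_two_mul_sum_min {α : Type*} [Fintype α] {f g : α → ℝ}
    (hf : ∀ x, 0 ≤ f x) (hg : ∀ x, 0 ≤ g x) (hf1 : ∑ x, f x = 1) (hg1 : ∑ x, g x = 1) :
    (∑ x, √(f x * g x)) ^ 2 ≤ 2 * ∑ x, min (f x) (g x) := by
  have hmin : ∀ x, 0 ≤ min (f x) (g x) := fun x => le_min (hf x) (hg x)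
  have hmax : ∀ x, 0 ≤ max (f x) (g x) := fun x => (hf x).trans (le_max_left _ _)
  have hcs := Finset.sum_mul_sq_le_sq_mul_sq Finset.univ (fun x => √(max (f x) (g x)))
    fun x => √(min (f x) (g x))
  simp only [Real.sq_sqrt (hmin _), Real.sq_sqrt (hmax _), ← Real.sqrt_mul (hmax _),
    max_mul_min] at hcs
  refine hcs.trans (mul_le_mul_of_nonneg_right ?_ (Finset.sum_nonneg fun x _ => hmin x))
  calc _ ≤ ∑ x, (f x + g x) := Finset.sum_le_sum fun x _ => max_le_add_of_nonneg (hf x) (hg x)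
    _ = 2 := by rw [Finset.sum_add_distrib, hf1, hg1]; norm_num

lemma sum_pi_prod {N : ℕ} {α : Type*} [Fintype α] (f : α → ℝ) :
    ∑ y : Fin N → α, ∏ k, f (y k) = (∑ x, f x) ^ N := by
  classical
  have := Finset.prod_univ_sum (fun _ : Fin N => (Finset.univ : Finset α)) (fun _ x => f x)
  rw [Fintype.piFinset_univ] at this
  rw [← this]
  simp

/-- The bias vector `η θ` of a sign pattern `θ`. -/
noncomputable def signBias {d : ℕ} (η : ℝ) (θ : Fin d → Bool) (i : Fin d) : ℝ := η * boolSign (θ i)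

lemma signBias_sq {d : ℕ} (η : ℝ) (θ : Fin d → Bool) (i : Fin d) :
    signBias η θ i ^ 2 = η ^ 2 := by
  rw [signBias, mul_pow, boolSign_sq, mul_one]

lemma abs_signBias_le_one {d : ℕ} {η : ℝ} (hη : η ^ 2 ≤ 1) (θ : Fin d → Bool) (i : Fin d) :
    |signBias η θ i| ≤ 1 :=
  abs_le_one_iff_mul_self_le_one.mpr (by rw [← sq, signBias_sq]; exact hη)

/-- The sign pattern `θ` with its `i`-th sign flipped. -/
noncomputable def flipSign {d : ℕ} (i : Fin d) (θ : Fin d → Bool) : Fin d → Bool :=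
  Function.update θ i (!θ i)

lemma flipSign_involutive {d : ℕ} (i : Fin d) : Function.Involutive (flipSign i) := by
  intro θ
  simp [flipSign]

lemma sum_sqrt_signWeight_flipSign {d : ℕ} {η : ℝ} (hη : η ^ 2 ≤ 1) (i : Fin d)
    (θ : Fin d → Bool) :
    ∑ ω, √(signWeight (signBias η θ) ω * signWeight (signBias η (flipSign i θ)) ω) =
      √(1 - η ^ 2) := by
  have hn := fun θ' : Fin d → Bool => fun j b =>
    signFactor_nonneg (abs_signBias_le_one hη θ' j) b
  have := Finset.prod_univ_sum (fun _ : Fin d => (Finset.univ : Finset Bool))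
    (fun j b => √((1 + signBias η θ j * boolSign b) / 2 *
      ((1 + signBias η (flipSign i θ) j * boolSign b) / 2)))
  rw [Fintype.piFinset_univ] at this
  have e : ∀ ω, √(signWeight (signBias η θ) ω * signWeight (signBias η (flipSign i θ)) ω) =
      ∏ j, √((1 + signBias η θ j * boolSign (ω j)) / 2 *
      ((1 + signBias η (flipSign i θ) j * boolSign (ω j)) / 2)) := fun ω => by
    rw [signWeight, signWeight, ← Finset.prod_mul_distrib, Real.sqrt_prod]
    exact fun j _ => mul_nonneg (hn _ _ _) (hn _ _ _)
  simp only [e]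
  rw [← this, Finset.prod_eq_single i]
  · have hs : √(1 - η ^ 2) = √((1 - η ^ 2) / 4) + √((1 - η ^ 2) / 4) := by
      rw [show (1 - η ^ 2) = 2 ^ 2 * ((1 - η ^ 2) / 4) by ring, Real.sqrt_mul (by norm_num),
        Real.sqrt_sq (by norm_num)]
      ring_nf
    rw [hs, Fintype.sum_bool]
    congr 2 <;> cases h : θ i <;>
      simp only [signBias, flipSign, Function.update_self, h, boolSign_true, boolSign_false,
        Bool.not_true, Bool.not_false] <;> ring
  · intro j _ hj
    have hb : signBias η (flipSign i θ) j = signBias η θ j := by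
      simp [signBias, flipSign, Function.update_of_ne hj]
    simp only [hb, Real.sqrt_mul_self (hn θ j _)]
    simp
    ring
  · simp

/-- The probability of the sample `y` of independent sign vectors with mean `η θ`. -/
noncomputable def sampleWeight {d N : ℕ} (η : ℝ) (θ : Fin d → Bool) (y : Fin N → Fin d → Bool) : ℝ :=
  ∏ k, signWeight (signBias η θ) (y k)

lemma sampleWeight_nonneg {d N : ℕ} {η : ℝ} (hη : η ^ 2 ≤ 1) (θ : Fin d → Bool)
    (y : Fin N → Fin d → Bool) : 0 ≤ sampleWeight η θ y :=
  Finset.prod_nonneg fun _ _ => signWeight_nonneg (abs_signBias_le_one hη θ) _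

lemma sum_sampleWeight {d N : ℕ} (η : ℝ) (θ : Fin d → Bool) :
    ∑ y : Fin N → Fin d → Bool, sampleWeight η θ y = 1 := by
  simp only [sampleWeight]
  rw [sum_pi_prod, sum_signWeight, one_pow]

/-- The affinity tensorizes, so its square is `(1 - η ^ 2) ^ N ≥ 1 - N η ^ 2 = 3 / 4` by Bernoulli.
-/
lemma three_eighths_le_sum_min_sampleWeight {d N : ℕ} (hN : 1 ≤ N) {η : ℝ}
    (hη : η ^ 2 = 1 / (4 * N)) (i : Fin d) (θ : Fin d → Bool) :
    3 / 8 ≤ ∑ y : Fin N → Fin d → Bool,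
      min (sampleWeight η θ y) (sampleWeight η (flipSign i θ) y) := by
  have hN' : (1 : ℝ) ≤ N := by exact_mod_cast hN
  have hη1 : η ^ 2 ≤ 1 := by
    rw [hη, div_le_one (by positivity)]
    linarith
  have h := sq_sum_sqrt_mul_le_two_mul_sum_min
    (sampleWeight_nonneg (N := N) hη1 θ) (sampleWeight_nonneg hη1 (flipSign i θ))
    (sum_sampleWeight η θ) (sum_sampleWeight η (flipSign i θ))
  have e : ∑ y : Fin N → Fin d → Bool, √(sampleWeight η θ y * sampleWeight η (flipSign i θ) y) =
      √(1 - η ^ 2) ^ N := by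
    rw [← sum_sqrt_signWeight_flipSign hη1 i θ, ← sum_pi_prod]
    refine Finset.sum_congr rfl fun y _ => ?_
    rw [sampleWeight, sampleWeight, ← Finset.prod_mul_distrib, Real.sqrt_prod]
    exact fun k _ => mul_nonneg (signWeight_nonneg (abs_signBias_le_one hη1 _) _)
      (signWeight_nonneg (abs_signBias_le_one hη1 _) _)
  rw [e, ← pow_mul, mul_comm N 2, pow_mul, Real.sq_sqrt (by linarith)] at h
  have hb := one_add_mul_le_pow (a := -η ^ 2) (by linarith) N
  have : (N : ℝ) * -η ^ 2 = -(1 / 4) := by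
    rw [hη]
    field_simp
  rw [this, ← sub_eq_add_neg, ← sub_eq_add_neg] at hb
  linarith

open Classical in
/-- Assouad's bound: averaged over the sign patterns, every estimator of the sign pattern has
a weighted Hamming risk comparable to the total weight. -/
lemma sum_sampleWeight_mul_hamming_ge {d N : ℕ} (hN : 1 ≤ N) {η : ℝ}
    (hη : η ^ 2 = 1 / (4 * N)) (m : Fin d → ℝ) (T : (Fin N → Fin d → Bool) → Fin d → ℝ) :
    ∑ _θ : Fin d → Bool, 3 / 16 * ∑ i, m i ^ 2 ≤ ∑ θ : Fin d → Bool, ∑ y,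
      sampleWeight η θ y * ∑ i, m i ^ 2 * if T y i * boolSign (θ i) ≤ 0 then 1 else 0 := by
  have hN' : (1 : ℝ) ≤ N := by exact_mod_cast hN
  have hη1 : η ^ 2 ≤ 1 := by
    rw [hη, div_le_one (by positivity)]
    linarith
  set A : Fin d → (Fin d → Bool) → ℝ := fun i θ => ∑ y, sampleWeight η θ y *
    if T y i * boolSign (θ i) ≤ 0 then 1 else 0 with hA
  -- No value of `T y i` has the strictly right sign for both patterns, so each sample pays at least
  -- the smaller weight.
  have hpair : ∀ i θ, 3 / 8 ≤ A i θ + A i (flipSign i θ) := fun i θ => by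
    refine (three_eighths_le_sum_min_sampleWeight hN hη i θ).trans ?_
    rw [hA, ← Finset.sum_add_distrib]
    refine Finset.sum_le_sum fun y _ => ?_
    have hs : boolSign (flipSign i θ i) = -boolSign (θ i) := by
      cases h : θ i <;> simp [flipSign, h]
    rw [hs]
    have h1 := sampleWeight_nonneg hη1 θ y
    have h2 := sampleWeight_nonneg hη1 (flipSign i θ) y
    rcases le_total (T y i * boolSign (θ i)) 0 with h | h
    · rw [if_pos h]
      have : (0 : ℝ) ≤ if T y i * -boolSign (θ i) ≤ 0 then 1 else 0 := by split_ifs <;> norm_num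
      nlinarith [min_le_left (sampleWeight η θ y) (sampleWeight η (flipSign i θ) y)]
    · rw [if_pos (show T y i * -boolSign (θ i) ≤ 0 by linarith)]
      have : (0 : ℝ) ≤ if T y i * boolSign (θ i) ≤ 0 then 1 else 0 := by split_ifs <;> norm_num
      nlinarith [min_le_right (sampleWeight η θ y) (sampleWeight η (flipSign i θ) y)]
  -- Flipping permutes the patterns, so summing the paired bound counts each pattern twice.
  have hi : ∀ i, ∑ _θ : Fin d → Bool, (3 / 16 : ℝ) ≤ ∑ θ, A i θ := fun i => by
    have h := Finset.sum_le_sum fun θ (_ : θ ∈ Finset.univ) => hpair i θ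
    rw [Finset.sum_add_distrib, (flipSign_involutive i).bijective.sum_comp (A i)] at h
    have h' : ∑ _θ : Fin d → Bool, (3 / 8 : ℝ) = 2 * ∑ _θ : Fin d → Bool, (3 / 16 : ℝ) := by
      rw [Finset.mul_sum]
      norm_num
    linarith
  calc _ = ∑ i, m i ^ 2 * ∑ _θ : Fin d → Bool, (3 / 16 : ℝ) := by
        simp only [← Finset.sum_mul, Finset.sum_const, nsmul_eq_mul]
        ring
    _ ≤ ∑ i, m i ^ 2 * ∑ θ, A i θ :=
        Finset.sum_le_sum fun i _ => mul_le_mul_of_nonneg_left (hi i) (sq_nonneg _)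
    _ = _ := by
        simp only [hA, Finset.mul_sum]
        rw [Finset.sum_comm]
        refine Finset.sum_congr rfl fun θ _ => ?_
        rw [Finset.sum_comm]
        exact Finset.sum_congr rfl fun y _ => Finset.sum_congr rfl fun i _ => by ring

open Classical in
/-- For some sign pattern, any estimator of the vector `θ i * m i` errs with positive probability
by a fixed proportion of the length of the vector. -/
lemma exists_signs_error_ge {d N : ℕ} (hN : 1 ≤ N) {η : ℝ}
    (hη : η ^ 2 = 1 / (4 * N)) (m : Fin d → ℝ) (hm : ∀ i, 0 ≤ m i)
    (T : (Fin N → Fin d → Bool) → Fin d → ℝ) :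
    ∃ θ : Fin d → Bool, 3 / 32 ≤ ∑ y, sampleWeight η θ y *
      if 3 / 32 * ∑ i, m i ^ 2 ≤ ∑ i, (T y i - boolSign (θ i) * m i) ^ 2 then 1 else 0 := by
  have hN' : (1 : ℝ) ≤ N := by exact_mod_cast hN
  have hη1 : η ^ 2 ≤ 1 := by
    rw [hη, div_le_one (by positivity)]
    linarith
  set M := ∑ i, m i ^ 2 with hM
  have hM0 : 0 ≤ M := Finset.sum_nonneg fun i _ => sq_nonneg _
  rcases hM0.eq_or_lt with h0 | hpos
  · refine ⟨fun _ => true, ?_⟩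
    have : ∀ y : Fin N → Fin d → Bool,
        3 / 32 * M ≤ ∑ i, (T y i - boolSign true * m i) ^ 2 := fun y => by
      rw [← h0, mul_zero]
      exact Finset.sum_nonneg fun i _ => sq_nonneg _
    simp only [this, if_true, mul_one, sum_sampleWeight]
    norm_num
  obtain ⟨θ, -, hθ⟩ := Finset.exists_le_of_sum_le Finset.univ_nonempty
    (sum_sampleWeight_mul_hamming_ge hN hη m T)
  refine ⟨θ, ?_⟩
  set B := ∑ y, sampleWeight η θ y *
    if 3 / 32 * M ≤ ∑ i, (T y i - boolSign (θ i) * m i) ^ 2 then (1 : ℝ) else 0 with hB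
  -- Reverse Markov: the Hamming loss is at most both `M` and the squared error. Since its mean is
  -- at least `3 / 16 * M`, the threshold `3 / 32 * M` leaves probability `3 / 32`.
  have hle : ∑ y, sampleWeight η θ y *
      ∑ i, m i ^ 2 * (if T y i * boolSign (θ i) ≤ 0 then 1 else 0) ≤ M * B + 3 / 32 * M := by
    have e : 3 / 32 * M = ∑ y : Fin N → Fin d → Bool, 3 / 32 * M * sampleWeight η θ y := by
      rw [← Finset.mul_sum, sum_sampleWeight, mul_one]
    conv_rhs => rw [e, hB, Finset.mul_sum, ← Finset.sum_add_distrib]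
    refine Finset.sum_le_sum fun y _ => ?_
    have hw := sampleWeight_nonneg hη1 θ y
    have hZM : ∑ i, m i ^ 2 * (if T y i * boolSign (θ i) ≤ 0 then (1 : ℝ) else 0) ≤ M :=
      Finset.sum_le_sum fun i _ => by split_ifs <;> nlinarith [sq_nonneg (m i)]
    have hZT : ∑ i, m i ^ 2 * (if T y i * boolSign (θ i) ≤ 0 then (1 : ℝ) else 0) ≤
        ∑ i, (T y i - boolSign (θ i) * m i) ^ 2 := Finset.sum_le_sum fun i _ => by
      split_ifs with h
      · nlinarith [mul_nonneg (hm i) (neg_nonneg.mpr h), sq_nonneg (T y i), boolSign_sq (θ i)]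
      · simpa using sq_nonneg _
    calc _ ≤ sampleWeight η θ y * (M * (if 3 / 32 * M ≤
          ∑ i, (T y i - boolSign (θ i) * m i) ^ 2 then (1 : ℝ) else 0) + 3 / 32 * M) := by
          refine mul_le_mul_of_nonneg_left ?_ hw
          split_ifs with h <;> linarith
      _ = _ := by ring
  have : M * (3 / 32) ≤ M * B := by linarith
  exact le_of_mul_le_mul_left this hpos

/-! ### Realizing the sign vectors as distributions on `ℝ^d` -/

/-- The law of independent signs with means `h i`. -/
noncomputable def signLaw {n : ℕ} (h : Fin n → ℝ) : Measure (Fin n → Bool) :=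
  ∑ ω, ENNReal.ofReal (signWeight h ω) • Measure.dirac ω

lemma signLaw_singleton {n : ℕ} (h : Fin n → ℝ) (ω : Fin n → Bool) :
    signLaw h {ω} = ENNReal.ofReal (signWeight h ω) := by
  rw [signLaw, Measure.finsetSum_apply, Finset.sum_eq_single ω]
  · simp
  · intro ω' _ hne
    simp [hne]
  · simp

lemma isProbabilityMeasure_signLaw {n : ℕ} {h : Fin n → ℝ} (hh : ∀ i, |h i| ≤ 1) :
    IsProbabilityMeasure (signLaw h) := by
  refine ⟨?_⟩
  simp only [signLaw, Measure.finsetSum_apply, Measure.smul_apply, measure_univ, smul_eq_mul,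
    mul_one]
  rw [← ENNReal.ofReal_sum_of_nonneg fun ω _ => signWeight_nonneg hh ω, sum_signWeight,
    ENNReal.ofReal_one]

lemma integral_signLaw {n : ℕ} {h : Fin n → ℝ} (hh : ∀ i, |h i| ≤ 1) {F : Type*}
    [NormedAddCommGroup F] [NormedSpace ℝ F] [CompleteSpace F] (f : (Fin n → Bool) → F) :
    ∫ ω, f ω ∂signLaw h = ∑ ω, signWeight h ω • f ω := by
  have := isProbabilityMeasure_signLaw hh
  rw [integral_fintype Integrable.of_finite]
  refine Finset.sum_congr rfl fun ω _ => ?_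
  rw [Measure.real, signLaw_singleton, ENNReal.toReal_ofReal (signWeight_nonneg hh ω)]

section SignPoint

variable {d : ℕ} (b : OrthonormalBasis (Fin d) ℝ (EuclideanSpace ℝ (Fin d))) (a h : Fin d → ℝ)

/-- The point with coordinates `± a i` in the orthonormal basis `b`. -/
noncomputable def signPoint (ω : Fin d → Bool) : EuclideanSpace ℝ (Fin d) :=
  ∑ i, (a i * boolSign (ω i)) • b i

/-- The law of the random point with independent coordinates `± a i` of means `a i * h i` in the
orthonormal basis `b`. -/
noncomputable def signPointLaw : Measure (EuclideanSpace ℝ (Fin d)) :=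
  (signLaw h).map (signPoint b a)

lemma measurable_signPoint : Measurable (signPoint b a) := measurable_of_finite _

lemma signPoint_sub (ω : Fin d → Bool) :
    signPoint b a ω - ∑ i, (a i * h i) • b i = ∑ i, (a i * (boolSign (ω i) - h i)) • b i := by
  rw [signPoint, ← Finset.sum_sub_distrib]
  exact Finset.sum_congr rfl fun i _ => by rw [← sub_smul, mul_sub]

lemma inner_signPoint_sub (ω : Fin d → Bool) (v : EuclideanSpace ℝ (Fin d)) :
    inner ℝ (signPoint b a ω - ∑ i, (a i * h i) • b i) v =
      signDev (fun i => a i * inner ℝ (b i) v) h ω := by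
  rw [signPoint_sub, sum_inner, signDev]
  refine Finset.sum_congr rfl fun i _ => ?_
  rw [real_inner_smul_left]
  ring

lemma signPoint_sub_apply (ω : Fin d → Bool) (j : Fin d) :
    signPoint b a ω j - (∑ i, (a i * h i) • b i : EuclideanSpace ℝ (Fin d)) j =
      signDev (fun i => a i * b i j) h ω := by
  have h1 := congrArg (fun x : EuclideanSpace ℝ (Fin d) => x j) (signPoint_sub b a h ω)
  simp only [PiLp.sub_apply] at h1
  rw [h1, signDev, WithLp.ofLp_sum, Finset.sum_apply]
  refine Finset.sum_congr rfl fun i _ => ?_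
  simp only [PiLp.smul_apply, smul_eq_mul]
  ring

variable {h}

lemma integral_signPoint (hh : ∀ i, |h i| ≤ 1) :
    ∫ ω, signPoint b a ω ∂signLaw h = ∑ i, (a i * h i) • b i := by
  rw [integral_signLaw hh, ← sub_eq_zero]
  have : ∑ ω, signWeight h ω • signPoint b a ω - ∑ i, (a i * h i) • b i =
      ∑ ω, signWeight h ω • (signPoint b a ω - ∑ i, (a i * h i) • b i) := by
    simp only [smul_sub, Finset.sum_sub_distrib, ← Finset.sum_smul, sum_signWeight, one_smul]
  rw [this]
  refine ext_inner_right ℝ fun v => ?_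
  simp only [sum_inner, real_inner_smul_left, inner_signPoint_sub, sum_signWeight_mul_signDev,
    inner_zero_left]

lemma distMean_signPointLaw (hh : ∀ i, |h i| ≤ 1) :
    distMean (signPointLaw b a h) = ∑ i, (a i * h i) • b i := by
  rw [distMean, signPointLaw, integral_map (measurable_signPoint b a).aemeasurable
    (by fun_prop), integral_signPoint b a hh]

lemma distCov_signPointLaw (hh : ∀ i, |h i| ≤ 1) (i j : Fin d) :
    distCov (signPointLaw b a h) i j =
      ∑ k, a k ^ 2 * (1 - h k ^ 2) * (b k i * b k j) := by
  have := isProbabilityMeasure_signLaw hh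
  have hmean : ∀ i, ∫ ω, signPoint b a ω i ∂signLaw h =
      (∑ k, (a k * h k) • b k : EuclideanSpace ℝ (Fin d)) i := fun i => by
    rw [← integral_signPoint b a hh]
    exact (EuclideanSpace.proj (𝕜 := ℝ) i).integral_comp_comm Integrable.of_finite
  rw [distCov, Matrix.of_apply, signPointLaw, covariance_map_fun
    (by fun_prop) (by fun_prop) (measurable_signPoint b a).aemeasurable, covariance]
  simp only [hmean, signPoint_sub_apply, integral_signLaw hh, smul_eq_mul,
    sum_signWeight_mul_signDev_mul]
  exact Finset.sum_congr rfl fun k _ => by ring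

/-- By Parseval, the variance along a unit vector is a convex combination of the `a i ^ 2 * (1 - h i
^ 2)`. -/
lemma boundedMomentClass_signPointLaw {p : ℝ} (hp : 2 ≤ p) (hp' : p ≤ 3)
    (hh : ∀ i, h i ^ 2 ≤ 1 / 3) (hv : ∀ i, a i ^ 2 * (1 - h i ^ 2) ≤ 1 / 2) :
    BoundedMomentClass p (signPointLaw b a h) := by
  have hh' : ∀ i, |h i| ≤ 1 := fun i =>
    abs_le_one_iff_mul_self_le_one.mpr (by nlinarith [hh i])
  have := isProbabilityMeasure_signLaw hh'
  have hm := (measurable_signPoint b a).aemeasurable (μ := signLaw h)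
  refine ⟨Measure.isProbabilityMeasure_map hm, ?_, fun v hv1 => ?_⟩
  · exact (integrable_map_measure aestronglyMeasurable_id hm).mpr Integrable.of_finite
  rw [distMean_signPointLaw b a hh', signPointLaw,
    lintegral_map (by fun_prop) (measurable_signPoint b a)]
  simp only [inner_signPoint_sub]
  rw [← ofReal_integral_eq_lintegral_ofReal Integrable.of_finite
    (Filter.Eventually.of_forall fun ω => by positivity), integral_signLaw hh']
  refine ENNReal.ofReal_le_one.mpr
    (sum_signWeight_mul_abs_signDev_rpow_le_one hp hp' _ h hh ?_)
  have hn : ∑ i, inner ℝ (b i) v ^ 2 = 1 := by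
    have := b.sum_sq_norm_inner_right v
    simpa [hv1] using this
  calc _ ≤ ∑ i, 1 / 2 * inner ℝ (b i) v ^ 2 := Finset.sum_le_sum fun i _ => by
        nlinarith [hv i, sq_nonneg (inner ℝ (b i) v)]
    _ = 1 / 2 := by rw [← Finset.mul_sum, hn, mul_one]

end SignPoint

lemma contaminated_self {d : ℕ} {ε : ℝ} (h0 : 0 ≤ ε) (h1 : ε ≤ 1)
    (P : Measure (EuclideanSpace ℝ (Fin d))) : contaminated ε P P = P := by
  rw [contaminated, ← add_smul, ← ENNReal.ofReal_add (by linarith) h0, sub_add_cancel,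
    ENNReal.ofReal_one, one_smul]

open Classical in
lemma errorProb_signPointLaw {d N : ℕ} {ε : ℝ} (h0 : 0 ≤ ε) (h1 : ε ≤ 1)
    {est : (Fin N → EuclideanSpace ℝ (Fin d)) → EuclideanSpace ℝ (Fin d)} (hest : Measurable est)
    (b : OrthonormalBasis (Fin d) ℝ (EuclideanSpace ℝ (Fin d))) (a : Fin d → ℝ) {η : ℝ}
    (hη : η ^ 2 ≤ 1) (θ : Fin d → Bool) (r : ℝ) :
    errorProb ε est (signPointLaw b a (signBias η θ)) (signPointLaw b a (signBias η θ)) r =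
      ENNReal.ofReal (∑ y, sampleWeight η θ y * if r ≤ ‖est (fun k => signPoint b a (y k)) -
        ∑ i, (a i * signBias η θ i) • b i‖ then 1 else 0) := by
  have hh := abs_signBias_le_one hη θ
  have := isProbabilityMeasure_signLaw hh
  have hm := measurable_signPoint b a
  have := Measure.isProbabilityMeasure_map (μ := signLaw (signBias η θ)) hm.aemeasurable
  rw [errorProb, sampleLaw, contaminated_self h0 h1, distMean_signPointLaw b a hh, signPointLaw,
    ← Measure.pi_map_pi fun _ => hm.aemeasurable, Measure.map_apply (measurable_of_finite _)
      (measurableSet_le measurable_const (by fun_prop)), Set.preimage_ofPred_eq]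
  have hs : {y : Fin N → Fin d → Bool | r ≤ ‖est (fun k => signPoint b a (y k)) -
      ∑ i, (a i * signBias η θ i) • b i‖} = ((Finset.univ.filter fun y : Fin N → Fin d → Bool => r ≤
        ‖est (fun k => signPoint b a (y k)) - ∑ i, (a i * signBias η θ i) • b i‖ : Finset _) :
        Set (Fin N → Fin d → Bool)) := by simp
  rw [hs, ← sum_measure_singleton, Finset.sum_filter,
    ENNReal.ofReal_sum_of_nonneg fun y _ => mul_nonneg (sampleWeight_nonneg hη θ y)
      (by split_ifs <;> norm_num)]
  refine Finset.sum_congr rfl fun y _ => ?_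
  rw [Measure.pi_singleton]
  simp only [signLaw_singleton]
  rw [← ENNReal.ofReal_prod_of_nonneg fun k _ => signWeight_nonneg hh (y k)]
  split_ifs <;> simp [sampleWeight]

/-! ### Lower bound for a prescribed covariance -/

lemma Matrix.IsHermitian.apply_eq_sum_eigenvalues {d : ℕ} {S : Matrix (Fin d) (Fin d) ℝ}
    (hS : S.IsHermitian) (i j : Fin d) :
    S i j = ∑ k, hS.eigenvalues k * (hS.eigenvectorBasis k i * hS.eigenvectorBasis k j) := by
  conv_lhs => rw [hS.spectral_theorem]
  rw [Unitary.conjStarAlgAut_apply, Matrix.mul_apply]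
  refine Finset.sum_congr rfl fun k _ => ?_
  simp [Matrix.mul_diagonal, Matrix.star_apply]
  ring

lemma Matrix.IsHermitian.eigenvalues_le_of_quadratic_le {d : ℕ} {S : Matrix (Fin d) (Fin d) ℝ}
    (hS : S.IsHermitian) {c : ℝ} (hc : ∀ v : Fin d → ℝ, v ⬝ᵥ (S *ᵥ v) ≤ c * (v ⬝ᵥ v))
    (k : Fin d) : hS.eigenvalues k ≤ c := by
  have h := hc (hS.eigenvectorBasis k).ofLp
  have h1 : (hS.eigenvectorBasis k).ofLp ⬝ᵥ (hS.eigenvectorBasis k).ofLp = 1 := by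
    have := EuclideanSpace.real_norm_sq_eq (hS.eigenvectorBasis k)
    rw [hS.eigenvectorBasis.orthonormal.1 k] at this
    simp only [dotProduct, ← sq]
    linarith
  rw [hS.mulVec_eigenvectorBasis, dotProduct_smul, h1] at h
  simpa using h

/-- The covariance part of the lower bound: for a prescribed covariance matrix of operator norm
at most `1 / 2`, every estimator errs by `√(tr S / N) / 8` for some distribution in the class. -/
lemma exists_errorProb_ge_of_cov {p : ℝ} {d N : ℕ} {ε : ℝ} (hp : 2 ≤ p) (hp' : p ≤ 3)
    (hN : 1 ≤ N) (h0 : 0 ≤ ε) (h1 : ε ≤ 1)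
    {est : (Fin N → EuclideanSpace ℝ (Fin d)) → EuclideanSpace ℝ (Fin d)} (hest : Measurable est)
    {S : Matrix (Fin d) (Fin d) ℝ} (hS : S.PosSemidef)
    (hS2 : ∀ v : Fin d → ℝ, v ⬝ᵥ (S *ᵥ v) ≤ (1 / 2) * (v ⬝ᵥ v)) :
    ∃ P, BoundedMomentClass p P ∧ distCov P = S ∧
      ENNReal.ofReal (3 / 32) ≤ errorProb ε est P P (1 / 8 * √(S.trace / N)) := by
  have hN' : (1 : ℝ) ≤ N := by exact_mod_cast hN
  set η : ℝ := √(1 / (4 * N)) with hηdef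
  have hη : η ^ 2 = 1 / (4 * N) := Real.sq_sqrt (by positivity)
  have hη0 : 0 ≤ η := Real.sqrt_nonneg _
  have hη4 : η ^ 2 ≤ 1 / 4 := by
    rw [hη, div_le_div_iff₀ (by positivity) (by norm_num)]
    linarith
  have hη1 : η ^ 2 ≤ 1 := by linarith
  set b := hS.isHermitian.eigenvectorBasis with hb
  set lam := hS.isHermitian.eigenvalues with hlam
  have hlam0 : ∀ i, 0 ≤ lam i := fun i => hS.eigenvalues_nonneg i
  -- The bias lowers a sign's variance to `1 - η ^ 2`; dividing by it restores the eigenvalue.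
  set a : Fin d → ℝ := fun i => √(lam i / (1 - η ^ 2)) with ha
  have ha2 : ∀ i, a i ^ 2 * (1 - η ^ 2) = lam i := fun i => by
    rw [ha, Real.sq_sqrt (div_nonneg (hlam0 i) (by linarith))]
    exact div_mul_cancel₀ _ (by linarith)
  obtain ⟨θ, hθ⟩ := exists_signs_error_ge hN hη (fun i => η * a i)
    (fun i => mul_nonneg hη0 (Real.sqrt_nonneg _))
    fun y i => inner ℝ (b i) (est fun k => signPoint b a (y k))
  refine ⟨signPointLaw b a (signBias η θ), boundedMomentClass_signPointLaw b a hp hp' ?_ ?_, ?_, ?_⟩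
  · intro i
    rw [signBias_sq]
    linarith
  · intro i
    rw [signBias_sq, ha2]
    exact hS.isHermitian.eigenvalues_le_of_quadratic_le hS2 i
  · ext i j
    rw [distCov_signPointLaw b a (abs_signBias_le_one hη1 θ),
      hS.isHermitian.apply_eq_sum_eigenvalues i j]
    simp only [signBias_sq, ha2, hb, hlam]
  · rw [errorProb_signPointLaw h0 h1 hest b a hη1]
    refine ENNReal.ofReal_le_ofReal (hθ.trans (Finset.sum_le_sum fun y _ =>
      mul_le_mul_of_nonneg_left ?_ (sampleWeight_nonneg hη1 θ y)))
    set t := est fun k => signPoint b a (y k)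
    have hnorm : ∑ i, (inner ℝ (b i) t - boolSign (θ i) * (η * a i)) ^ 2 =
        ‖t - ∑ i, (a i * signBias η θ i) • b i‖ ^ 2 := by
      rw [← b.sum_sq_norm_inner_right]
      refine Finset.sum_congr rfl fun i _ => ?_
      rw [inner_sub_right, inner_sum, Real.norm_eq_abs, sq_abs]
      simp only [real_inner_smul_right, b.inner_eq_ite, mul_ite, mul_one, mul_zero,
        Finset.sum_ite_eq, Finset.mem_univ, if_true, signBias]
      ring
    -- With this, the squared radius `S.trace / (64 * N)` is at most `1 / 16` of the squared length,
    -- below the proportion `3 / 32`.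
    have htr : S.trace / N ≤ 4 * ∑ i, (η * a i) ^ 2 := by
      have e : S.trace = ∑ i, lam i := by simpa using hS.isHermitian.trace_eq_sum_eigenvalues
      rw [e, Finset.sum_div, Finset.mul_sum]
      refine Finset.sum_le_sum fun i _ => ?_
      rw [mul_pow, hη, ← ha2 i]
      have : a i ^ 2 * (1 - η ^ 2) / N ≤ a i ^ 2 / N :=
        div_le_div_of_nonneg_right (by nlinarith [sq_nonneg (a i), sq_nonneg η]) (by linarith)
      refine this.trans (le_of_eq ?_)
      field_simp
    rw [hnorm]
    split_ifs with hA hB hB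
    · exact le_rfl
    · refine absurd ?_ hB
      refine abs_le_of_sq_le_sq' ?_ (norm_nonneg _) |>.2
      have htr0 : 0 ≤ S.trace / N := div_nonneg hS.trace_nonneg (by linarith)
      rw [mul_pow, Real.sq_sqrt htr0]
      have : 0 ≤ ∑ i, (η * a i) ^ 2 := Finset.sum_nonneg fun i _ => sq_nonneg _
      linarith
    · norm_num
    · exact le_rfl

/-! ### Lower bound from contamination -/

/-- The law that puts mass `t` at `z` and mass `1 - t` at the origin. -/
noncomputable def twoPointLaw {d : ℕ} (t : ℝ) (z : EuclideanSpace ℝ (Fin d)) :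
    Measure (EuclideanSpace ℝ (Fin d)) :=
  contaminated t (Measure.dirac 0) (Measure.dirac z)

lemma isProbabilityMeasure_contaminated {d : ℕ} {ε : ℝ} (h0 : 0 ≤ ε) (h1 : ε ≤ 1)
    (P Q : Measure (EuclideanSpace ℝ (Fin d))) [IsProbabilityMeasure P] [IsProbabilityMeasure Q] :
    IsProbabilityMeasure (contaminated ε P Q) := by
  refine ⟨?_⟩
  simp only [contaminated, Measure.add_apply, Measure.smul_apply, measure_univ, smul_eq_mul,
    mul_one]
  rw [← ENNReal.ofReal_add (by linarith) h0, sub_add_cancel, ENNReal.ofReal_one]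

section TwoPoint

variable {d : ℕ} {t : ℝ} (z : EuclideanSpace ℝ (Fin d))

lemma isProbabilityMeasure_twoPointLaw (h0 : 0 ≤ t) (h1 : t ≤ 1) :
    IsProbabilityMeasure (twoPointLaw t z) :=
  isProbabilityMeasure_contaminated h0 h1 _ _

lemma integrable_twoPointLaw {F : Type*} [NormedAddCommGroup F]
    (f : EuclideanSpace ℝ (Fin d) → F) : Integrable f (twoPointLaw t z) :=
  ((integrable_dirac (by simp)).smul_measure ENNReal.ofReal_ne_top).add_measure
    ((integrable_dirac (by simp)).smul_measure ENNReal.ofReal_ne_top)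

lemma integral_twoPointLaw (h0 : 0 ≤ t) (h1 : t ≤ 1) {F : Type*} [NormedAddCommGroup F]
    [NormedSpace ℝ F] [CompleteSpace F] (f : EuclideanSpace ℝ (Fin d) → F) :
    ∫ x, f x ∂twoPointLaw t z = (1 - t) • f 0 + t • f z := by
  rw [twoPointLaw, contaminated, integral_add_measure
    ((integrable_dirac (by simp)).smul_measure ENNReal.ofReal_ne_top)
    ((integrable_dirac (by simp)).smul_measure ENNReal.ofReal_ne_top), integral_smul_measure,
    integral_smul_measure, integral_dirac, integral_dirac, ENNReal.toReal_ofReal h0,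
    ENNReal.toReal_ofReal (by linarith)]

lemma distMean_twoPointLaw (h0 : 0 ≤ t) (h1 : t ≤ 1) : distMean (twoPointLaw t z) = t • z := by
  rw [distMean, integral_twoPointLaw z h0 h1, smul_zero, zero_add]

lemma trace_distCov_twoPointLaw (h0 : 0 ≤ t) (h1 : t ≤ 1) :
    (distCov (twoPointLaw t z)).trace = t * (1 - t) * ‖z‖ ^ 2 := by
  rw [EuclideanSpace.real_norm_sq_eq, Finset.mul_sum, Matrix.trace]
  refine Finset.sum_congr rfl fun i _ => ?_
  rw [Matrix.diag_apply, distCov, Matrix.of_apply, covariance, integral_twoPointLaw z h0 h1,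
    integral_twoPointLaw z h0 h1]
  simp only [PiLp.zero_apply, smul_eq_mul]
  ring

/-- Centering costs nothing: for `p ≥ 2`, `(1 - t) * t ^ p + t * (1 - t) ^ p ≤ t * (1 - t) ≤ t`. -/
lemma boundedMomentClass_twoPointLaw {p : ℝ} (hp : 2 ≤ p) (h0 : 0 ≤ t) (h1 : t ≤ 1)
    (hz : t * ‖z‖ ^ p ≤ 1) : BoundedMomentClass p (twoPointLaw t z) := by
  refine ⟨isProbabilityMeasure_twoPointLaw z h0 h1, integrable_twoPointLaw z _, fun v hv => ?_⟩
  rw [← ofReal_integral_eq_lintegral_ofReal (integrable_twoPointLaw z _)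
    (Filter.Eventually.of_forall fun ω => by positivity), integral_twoPointLaw z h0 h1,
    distMean_twoPointLaw z h0 h1]
  refine ENNReal.ofReal_le_one.mpr ?_
  have hs : 0 ≤ 1 - t := by linarith
  have hzv : |inner ℝ z v| ^ p ≤ ‖z‖ ^ p := Real.rpow_le_rpow (abs_nonneg _)
    (by simpa [hv] using abs_real_inner_le_norm z v) (by linarith)
  have hsq : ∀ s : ℝ, 0 ≤ s → s ≤ 1 → s ^ p ≤ s ^ 2 := fun s hs0 hs1 => by
    simpa using Real.rpow_le_rpow_of_exponent_ge' hs0 hs1 (by norm_num) hp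
  have e1 : |inner ℝ (0 - t • z) v| = t * |inner ℝ z v| := by
    rw [zero_sub, inner_neg_left, abs_neg, real_inner_smul_left, abs_mul, abs_of_nonneg h0]
  have e2 : |inner ℝ (z - t • z) v| = (1 - t) * |inner ℝ z v| := by
    rw [show z - t • z = (1 - t) • z by rw [sub_smul, one_smul], real_inner_smul_left, abs_mul, abs_of_nonneg hs]
  rw [e1, e2, Real.mul_rpow h0 (abs_nonneg _), Real.mul_rpow hs (abs_nonneg _), smul_eq_mul,
    smul_eq_mul]
  have hA : 0 ≤ |inner ℝ z v| ^ p := by positivity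
  have hB : t * |inner ℝ z v| ^ p ≤ 1 := (mul_le_mul_of_nonneg_left hzv h0).trans hz
  calc _ = ((1 - t) * t ^ p + t * (1 - t) ^ p) * |inner ℝ z v| ^ p := by ring
    _ ≤ ((1 - t) * t ^ 2 + t * (1 - t) ^ 2) * |inner ℝ z v| ^ p := by
        refine mul_le_mul_of_nonneg_right (add_le_add ?_ ?_) hA
        · exact mul_le_mul_of_nonneg_left (hsq t h0 h1) hs
        · exact mul_le_mul_of_nonneg_left (hsq _ hs (by linarith)) h0
    _ = (1 - t) * (t * |inner ℝ z v| ^ p) := by ring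
    _ ≤ 1 := by nlinarith [mul_nonneg h0 hA]

end TwoPoint

/-- Contaminating the Dirac mass at the origin and the two-point law of mass `ε` at `z` can lead
to the same distribution. -/
lemma contaminated_twoPointLaw_eq {d : ℕ} {ε : ℝ} (h0 : 0 ≤ ε) (h1 : ε ≤ 1)
    (z : EuclideanSpace ℝ (Fin d)) :
    contaminated ε (twoPointLaw 0 z) (twoPointLaw (1 - ε) z) =
      contaminated ε (twoPointLaw ε z) (twoPointLaw 0 z) := by
  -- Both mixtures put mass `ε * (1 - ε)` at `z` and the rest at the origin.
  have hs : 0 ≤ 1 - ε := by linarith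
  simp only [twoPointLaw, contaminated, sub_zero, sub_sub_cancel, ENNReal.ofReal_zero,
    ENNReal.ofReal_one, zero_smul, one_smul, add_zero, smul_add, smul_smul]
  rw [← add_assoc, ← add_smul, add_right_comm, ← add_smul, mul_comm (ENNReal.ofReal ε)]
  congr 2
  · rw [← ENNReal.ofReal_mul h0, ← ENNReal.ofReal_mul hs,
      ← ENNReal.ofReal_add hs (by positivity), ← ENNReal.ofReal_add (by positivity) h0]
    congr 1
    ring
  · exact mul_comm _ _

/-- Le Cam's two-point argument for indistinguishable contaminated distributions. -/
lemma half_le_errorProb_or {d N : ℕ} {ε : ℝ} (h0 : 0 ≤ ε) (h1 : ε ≤ 1)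
    (est : (Fin N → EuclideanSpace ℝ (Fin d)) → EuclideanSpace ℝ (Fin d))
    {P Q P' Q' : Measure (EuclideanSpace ℝ (Fin d))} [IsProbabilityMeasure P]
    [IsProbabilityMeasure Q] (h : contaminated ε P Q = contaminated ε P' Q') {r : ℝ}
    (hr : 2 * r ≤ ‖distMean P - distMean P'‖) :
    2⁻¹ ≤ errorProb ε est P Q r ∨ 2⁻¹ ≤ errorProb ε est P' Q' r := by
  have := isProbabilityMeasure_contaminated h0 h1 P Q
  have hlaw : sampleLaw N ε P' Q' = sampleLaw N ε P Q := by rw [sampleLaw, sampleLaw, h]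
  have hprob : IsProbabilityMeasure (sampleLaw N ε P Q) := by rw [sampleLaw]; infer_instance
  simp only [errorProb, hlaw]
  by_contra! hlt
  have hcover : (Set.univ : Set (Fin N → EuclideanSpace ℝ (Fin d))) ⊆
      {X | r ≤ ‖est X - distMean P‖} ∪ {X | r ≤ ‖est X - distMean P'‖} := fun X _ => by
    by_contra hX
    simp only [Set.mem_union, Set.mem_ofPred_eq, not_or, not_le] at hX
    have := norm_sub_le (est X - distMean P') (est X - distMean P)
    rw [sub_sub_sub_cancel_left] at this
    linarith [hX.1, hX.2]
  have := (measure_mono hcover).trans (measure_union_le (μ := sampleLaw N ε P Q) _ _)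
  rw [measure_univ, ← ENNReal.inv_two_add_inv_two] at this
  exact absurd this (not_le.mpr (ENNReal.add_lt_add hlt.1 hlt.2))

/-- The contamination part of the lower bound: when `ε ^ (1 - 1 / p)` is not dominated by
`√(1 / N)`, contamination hides a displacement of the mean of that size. -/
lemma exists_errorProb_ge_of_contamination {p : ℝ} {d N : ℕ} {ε : ℝ} (hp : 2 ≤ p)
    (hd : 1 ≤ d) (h0 : 0 < ε) (h1 : ε < 1)
    (hN : √(1 / (2 * N)) ≤ ε ^ (1 - 1 / p))
    (est : (Fin N → EuclideanSpace ℝ (Fin d)) → EuclideanSpace ℝ (Fin d)) :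
    ∃ P Q, BoundedMomentClass p P ∧ IsProbabilityMeasure Q ∧ 2⁻¹ ≤ errorProb ε est P Q
      (1 / 8 * max √((distCov P).trace / N) (ε ^ (1 - 1 / p))) := by
  have hp0 : 0 < p := by linarith
  -- The largest length allowed by `ε * ‖z‖ ^ p ≤ 1`, hence the largest mean shift `ε * ‖z‖`.
  set z : EuclideanSpace ℝ (Fin d) := EuclideanSpace.single ⟨0, hd⟩ (ε ^ (-(1 / p))) with hzdef
  have hz : ‖z‖ = ε ^ (-(1 / p)) := by
    rw [hzdef, PiLp.norm_single, Real.norm_of_nonneg (by positivity)]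
  have hzp : ε * ‖z‖ ^ p ≤ 1 := by
    rw [hz, ← Real.rpow_mul h0.le, neg_mul, one_div_mul_cancel hp0.ne', Real.rpow_neg_one,
      mul_inv_cancel₀ h0.ne']
  have hz2 : ε * ‖z‖ ^ 2 ≤ 1 := by
    refine le_trans (mul_le_mul_of_nonneg_left ?_ h0.le) hzp
    rw [← Real.rpow_natCast]
    refine Real.rpow_le_rpow_of_exponent_le ?_ (by exact_mod_cast hp)
    rw [hz]
    exact Real.one_le_rpow_of_pos_of_le_one_of_nonpos h0 h1.le
      (neg_nonpos.mpr (by positivity))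
  set Δ := ε ^ (1 - 1 / p) with hΔ
  have hΔ0 : 0 < Δ := Real.rpow_pos_of_pos h0 _
  have hmean : ‖ε • z‖ = Δ := by
    rw [norm_smul, hz, Real.norm_of_nonneg h0.le, hΔ, sub_eq_add_neg, Real.rpow_add h0,
      Real.rpow_one]
  have hsqrt : ∀ τ : ℝ, τ ≤ 1 → √(τ / N) ≤ 2 * Δ := fun τ hτ => by
    have e : (1 : ℝ) / N = 2 * (1 / (2 * N)) := by
      rcases Nat.eq_zero_or_pos N with rfl | hN0
      · simp
      · field_simp
    calc √(τ / N) ≤ √(2 ^ 2 * (1 / (2 * N))) := by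
          refine Real.sqrt_le_sqrt ((div_le_div_of_nonneg_right hτ (Nat.cast_nonneg N)).trans ?_)
          rw [e]
          have : (0 : ℝ) ≤ 1 / (2 * N) := by positivity
          linarith
      _ = 2 * √(1 / (2 * N)) := by rw [Real.sqrt_mul (by norm_num), Real.sqrt_sq (by norm_num)]
      _ ≤ 2 * Δ := by linarith
  have hfinal : ∀ (P Q : Measure (EuclideanSpace ℝ (Fin d))), BoundedMomentClass p P →
      IsProbabilityMeasure Q → (distCov P).trace ≤ 1 → 2⁻¹ ≤ errorProb ε est P Q (Δ / 2) →
      ∃ P Q, BoundedMomentClass p P ∧ IsProbabilityMeasure Q ∧ 2⁻¹ ≤ errorProb ε est P Q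
        (1 / 8 * max √((distCov P).trace / N) Δ) := fun P Q hP hQ hτ he => by
    refine ⟨P, Q, hP, hQ, he.trans (measure_mono fun X hX => ?_)⟩
    rw [Set.mem_ofPred_eq] at hX ⊢
    have : max √((distCov P).trace / N) Δ ≤ 2 * Δ := max_le (hsqrt _ hτ) (by linarith)
    linarith
  have := isProbabilityMeasure_twoPointLaw z le_rfl zero_le_one
  have := isProbabilityMeasure_twoPointLaw z (t := 1 - ε) (by linarith) (by linarith)
  rcases half_le_errorProb_or h0.le h1.le est (contaminated_twoPointLaw_eq h0.le h1.le z)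
    (r := Δ / 2) (by
      rw [distMean_twoPointLaw z le_rfl zero_le_one, distMean_twoPointLaw z h0.le h1.le,
        zero_smul, zero_sub, norm_neg, hmean]
      linarith) with h | h
  · refine hfinal _ _ (boundedMomentClass_twoPointLaw z hp le_rfl zero_le_one (by simp))
      inferInstance ?_ h
    rw [trace_distCov_twoPointLaw z le_rfl zero_le_one]
    simp
  · refine hfinal _ _ (boundedMomentClass_twoPointLaw z hp h0.le h1.le hzp) inferInstance ?_ h
    rw [trace_distCov_twoPointLaw z h0.le h1.le]
    nlinarith [mul_nonneg h0.le (sq_nonneg ‖z‖)]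

/-! ### Combining the two lower bounds -/

theorem mainTheorem5 :
    ∃ c₁ c₂ : ℝ, 0 < c₁ ∧ 0 < c₂ ∧
      ∀ (p : ℝ) (d N : ℕ) (ε : ℝ), 2 ≤ p → p ≤ 3 → 1 ≤ d → 1 ≤ N → 0 ≤ ε → ε < 1 / 2 →
      ∀ est : (Fin N → EuclideanSpace ℝ (Fin d)) → EuclideanSpace ℝ (Fin d), Measurable est →
        -- the supremum over the whole class, with the covariance matrix of `P` in the bound
        ENNReal.ofReal c₂ ≤
          (⨆ (P : Measure (EuclideanSpace ℝ (Fin d))) (Q : Measure (EuclideanSpace ℝ (Fin d)))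
            (_ : BoundedMomentClass p P) (_ : IsProbabilityMeasure Q),
            errorProb ε est P Q
              (c₁ * max (Real.sqrt ((distCov P).trace / N)) (ε ^ (1 - 1 / p)))) ∧
        -- the `√(tr Σ / N)` term already for a prescribed covariance matrix `Σ`
        ∀ S : Matrix (Fin d) (Fin d) ℝ, S.PosSemidef →
          (∀ v : Fin d → ℝ, v ⬝ᵥ (S *ᵥ v) ≤ (1 / 2) * (v ⬝ᵥ v)) →
          ENNReal.ofReal c₂ ≤
            (⨆ (P : Measure (EuclideanSpace ℝ (Fin d))) (Q : Measure (EuclideanSpace ℝ (Fin d)))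
              (_ : BoundedMomentClass p P) (_ : distCov P = S) (_ : IsProbabilityMeasure Q),
              errorProb ε est P Q (c₁ * Real.sqrt (S.trace / N))) := by

  refine ⟨1 / 8, 3 / 32, by norm_num, by norm_num, ?_⟩
  intro p d N ε hp hp' hd hN h0 h1 est hest
  refine ⟨?_, fun S hS hS2 => ?_⟩
  · have hd' : (1 : ℝ) ≤ d := by exact_mod_cast hd
    have hN' : (1 : ℝ) ≤ N := by exact_mod_cast hN
    -- The admissible covariance of largest trace. As `d ≥ 1`, its rate is at least `√(1 / (2 *
    -- N))`, the threshold needed in the contamination case.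
    set S : Matrix (Fin d) (Fin d) ℝ := (1 / 2 : ℝ) • 1 with hSdef
    have htr : S.trace = d / 2 := by
      rw [hSdef, Matrix.trace_smul, Matrix.trace_one, Fintype.card_fin, smul_eq_mul]
      ring
    rcases le_or_gt (ε ^ (1 - 1 / p)) √(S.trace / N) with hcase | hcase
    · obtain ⟨P, hP, hcov, he⟩ := exists_errorProb_ge_of_cov hp hp' hN h0 (by linarith) hest
        (S := S) (Matrix.PosSemidef.one.smul (by norm_num)) fun v => by
          rw [hSdef, Matrix.smul_mulVec, Matrix.one_mulVec, dotProduct_smul, smul_eq_mul]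
      refine le_iSup₂_of_le P P (le_iSup₂_of_le hP hP.isProb ?_)
      rwa [hcov, max_eq_left hcase]
    · have hp0 : 0 < 1 - 1 / p := by
        rw [sub_pos, div_lt_one (by linarith)]
        linarith
      have hε : 0 < ε := by
        refine h0.lt_of_ne fun h => ?_
        rw [← h, Real.zero_rpow hp0.ne'] at hcase
        exact absurd hcase (not_lt.mpr (Real.sqrt_nonneg _))
      obtain ⟨P, Q, hP, hQ, he⟩ := exists_errorProb_ge_of_contamination (N := N) hp hd hε
        (by linarith) (le_trans (Real.sqrt_le_sqrt (by
          rw [htr, div_div]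
          exact div_le_div_of_nonneg_right hd' (by positivity))) hcase.le) est
      refine le_iSup₂_of_le P Q (le_iSup₂_of_le hP hQ (le_trans ?_ he))
      rw [← ENNReal.ofReal_ofNat, ← ENNReal.ofReal_inv_of_pos (by norm_num)]
      exact ENNReal.ofReal_le_ofReal (by norm_num)
  · obtain ⟨P, hP, hcov, he⟩ := exists_errorProb_ge_of_cov hp hp' hN h0 (by linarith) hest hS hS2
    exact le_iSup₂_of_le P P (le_iSup₂_of_le hP hcov (le_iSup_of_le hP.isProb he))
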